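/- Let $q$ be a prime power, $\mathbb{F}_q$ the field with $q$ elements, and $F$ an arrangement of $q+1$ lines in $\mathbb{F}_q^2$, that is, a set of $q+1$ distinct one-dimensional affine subspaces of $\mathbb{F}_q^2$. A point has multiplicity $i$ with respect to an arrangement if exactly $i$ lines of the arrangement pass through it, and $x_i$ denotes the number of points of the plane of multiplicity $i$. Suppose that $A$ is an arrangement of lines in $\mathbb{R}^2$ (a finite set of distinct lines) with $|A|=|F|=q+1$ and $x_i(A)=x_i(F)$ for every $i\in\{2,\dots,q+1\}$. The lines of $A$ divide $\mathbb{R}^2$ into cells: two points belong to the same cell if, for each line $L$ of $A$, both lie on $L$ or both lie strictly on the same side of $L$. Let $f_1^b(A)$ and $f_2^b(A)$ be the numbers of bounded cells of dimension $1$ (bounded edges) and of dimension $2$ (bounded faces). Then $$f_1^b(A)=(q+1)(q-1)-x_1(F)\qquad\text{and}\qquad f_2^b(A)=x_0(F).$$ -/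

import Mathlib

/-- An arrangement of lines in an affine plane `V` over a field `k`: a finite set of (pairwise
distinct) lines, a line being a one-dimensional affine subspace. (The empty affine subspace is
excluded, because its direction has dimension `0`.) -/
structure LineArrangement (k V : Type*) [Field k] [AddCommGroup V] [Module k V] where
  lines : Finset (AffineSubspace k V)
  isLine : ∀ L ∈ lines, Module.finrank k L.direction = 1

namespace LineArrangement

section Incidence

variable {k V : Type*} [Field k] [AddCommGroup V] [Module k V]

/-- The number of lines of the arrangement. -/
def card (A : LineArrangement k V) : ℕ := A.lines.card

/-- The multiplicity of a point: the number of lines of the arrangement that pass through it. -/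
noncomputable def multiplicity (A : LineArrangement k V) (P : V) : ℕ :=
  {L : AffineSubspace k V | L ∈ A.lines ∧ P ∈ L}.ncard

/-- `A.numPoints i` is the number of points of the plane of multiplicity exactly `i`. It is used
for `i ≥ 2` over any field, and for `i = 0, 1` over a finite field only. -/
noncomputable def numPoints (A : LineArrangement k V) (i : ℕ) : ℕ :=
  {P : V | A.multiplicity P = i}.ncard

/-- Two arrangements, in planes over possibly different fields, are in the same class if they have
the same number `n` of lines and the same number of points of multiplicity `i`, for `2 ≤ i ≤ n`. -/
def SameClass {k' V' : Type*} [Field k'] [AddCommGroup V'] [Module k' V']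
    (A : LineArrangement k V) (B : LineArrangement k' V') : Prop :=
  A.card = B.card ∧ ∀ i ∈ Finset.Icc 2 A.card, A.numPoints i = B.numPoints i

end Incidence

section Cells

/-- Two points of the real plane lie in the same cell of the arrangement if, for every line `L` of
the arrangement, both lie on `L`, or both lie strictly on the same side of `L`. -/
def cellSetoid (A : LineArrangement ℝ (EuclideanSpace ℝ (Fin 2))) :
    Setoid (EuclideanSpace ℝ (Fin 2)) where
  r x y := ∀ L ∈ A.lines, (x ∈ L ∧ y ∈ L) ∨ L.SSameSide x y
  iseqv :=
    { refl := fun x L hL => by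
        by_cases hx : x ∈ L
        · exact Or.inl ⟨hx, hx⟩
        · have hne : (L : Set (EuclideanSpace ℝ (Fin 2))).Nonempty := by
            rw [AffineSubspace.nonempty_iff_ne_bot]
            rintro rfl
            have h := A.isLine _ hL
            rw [AffineSubspace.direction_bot, finrank_bot] at h
            exact zero_ne_one h
          exact Or.inr (AffineSubspace.sSameSide_self_iff.2 ⟨hne, hx⟩)
      symm := fun h L hL => (h L hL).imp And.symm AffineSubspace.SSameSide.symm
      trans := fun h₁ h₂ L hL => by
        rcases h₁ L hL with h | h <;> rcases h₂ L hL with h' | h'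
        · exact Or.inl ⟨h.1, h'.2⟩
        · exact absurd h.2 h'.2.1
        · exact absurd h'.1 h.2.2
        · exact Or.inr (h.trans h') }

/-- The cells that the arrangement determines in the real plane (vertices, open edges, open
faces). -/
def cells (A : LineArrangement ℝ (EuclideanSpace ℝ (Fin 2))) :
    Set (Set (EuclideanSpace ℝ (Fin 2))) :=
  A.cellSetoid.classes

/-- The number of bounded `i`-dimensional cells; the dimension of a cell is that of its affine
span. -/
noncomputable def numBoundedCells (A : LineArrangement ℝ (EuclideanSpace ℝ (Fin 2))) (i : ℕ) : ℕ :=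
  {C | C ∈ A.cells ∧ Module.finrank ℝ (vectorSpan ℝ C) = i ∧ Bornology.IsBounded C}.ncard

end Cells

end LineArrangement

/-!
Both planes are compared through the numbers `x_i` of points of multiplicity `i ≥ 2`.

*Real plane.* For an arrangement of `n` lines that has a vertex, every line `L` carries at least one
vertex, so that `L` has one bounded edge less than it has vertices. Summing over the lines gives
`f₁ = ∑ i * x_i - n` (`sum_card_bounded_edge_patterns`). The number of all faces is
`1 + n + ∑ (i - 1) * x_i`, by induction on the number of lines: a new line adds one face for each
old face that it crosses, and it crosses one face more than it has intersection points with the old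
lines (`card_patterns_univ`). In coordinates in which no line is vertical, consider two vertical
lines, one to the left and one to the right of all vertices. A face is unbounded if and only if it
meets one of these two; each meets `n + 1` faces, and only the bottom and the top face meet both,
because a line below a face and a line above it would otherwise have to be parallel. So there are
`2 * n` unbounded faces, and `f₂ = 1 - n + ∑ (i - 1) * x_i` (`card_bounded_patterns`). The faces are
encoded by the sets of lines that pass below them, and the one-dimensional counts are those of the
gaps in a finite set of reals (`card_patterns_line`, `card_bounded_patterns_line`).

*Finite plane.* Counting the `q ^ 2` points and the `(q + 1) * q` incidences of `q + 1` lines gives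
`x_0 + x_1 + ∑ x_i = q ^ 2` and `x_1 + ∑ i * x_i = (q + 1) * q`, the sums being over `i ≥ 2`. In
particular the lines cannot be pairwise disjoint, so the real arrangement has a vertex too, and
eliminating the sums from the four equations gives the result.
-/

open Finset Filter

/-! ### Sign patterns of a family of functions -/

/-- The sign pattern of the family `g i`, `i ∈ T`, at the point `p` is strict and equal to `X ⊆ T`:
the functions in `X` are positive at `p` and the functions in `T \ X` are negative. -/
def Realizes {ι M : Type*} (g : ι → M → ℝ) (T X : Finset ι) (p : M) : Prop :=
  (∀ i ∈ X, 0 < g i p) ∧ ∀ i ∈ T, i ∉ X → g i p < 0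

open Classical in
/-- The strict sign patterns, encoded as subsets of `T`, that are realized at some point of `U`. -/
noncomputable def patterns {ι M : Type*} (g : ι → M → ℝ) (T : Finset ι) (U : Set M) :
    Finset (Finset ι) :=
  {X ∈ T.powerset | ∃ p ∈ U, Realizes g T X p}

section Patterns

variable {ι M : Type*} {g : ι → M → ℝ} {T X : Finset ι} {U : Set M}

theorem mem_patterns : X ∈ patterns g T U ↔ X ⊆ T ∧ ∃ p ∈ U, Realizes g T X p := by
  simp [patterns]

open Classical in
theorem realizes_filter {p : M} (hp : ∀ i ∈ T, g i p ≠ 0) :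
    Realizes g T {i ∈ T | 0 < g i p} p := by
  refine ⟨fun i hi => (mem_filter.1 hi).2, fun i hi h => ?_⟩
  have : ¬ 0 < g i p := fun h' => h (mem_filter.2 ⟨hi, h'⟩)
  exact lt_of_le_of_ne (not_lt.1 this) (hp i hi)

open Classical in
theorem Realizes.eq_filter {p : M} (hX : X ⊆ T) (h : Realizes g T X p) :
    X = {i ∈ T | 0 < g i p} := by
  ext i
  refine ⟨fun hi => mem_filter.2 ⟨hX hi, h.1 i hi⟩, fun hi => ?_⟩
  by_contra hn
  exact lt_asymm (mem_filter.1 hi).2 (h.2 i (mem_filter.1 hi).1 hn)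

theorem Realizes.ne_zero {p : M} (h : Realizes g T X p) {i : ι} (hi : i ∈ T) : g i p ≠ 0 := by
  by_cases hX : i ∈ X
  · exact (h.1 i hX).ne'
  · exact (h.2 i hi hX).ne

end Patterns

/-! ### Affine functions on the real line -/

/-- A point outside the finite set `S` with exactly `k` elements of `S` below it. -/
theorem exists_card_filter_lt_eq (S : Finset ℝ) :
    ∀ M : ℝ, (∀ x ∈ S, x < M) → ∀ k ≤ #S, ∃ s < M, s ∉ S ∧ #{x ∈ S | x < s} = k := by
  induction S using Finset.induction_on_max with
  | empty =>
    intro M _ k hk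
    obtain rfl : k = 0 := by simpa using hk
    exact ⟨M - 1, by linarith, by simp, by simp⟩
  | insert m S hm ih =>
    intro M hM k hk
    have hmS : m ∉ S := fun h => lt_irrefl _ (hm m h)
    have hmM : m < M := hM m (mem_insert_self _ _)
    rw [card_insert_of_notMem hmS] at hk
    rcases hk.lt_or_eq with hk | rfl
    · obtain ⟨s, hs, hsS, hsk⟩ := ih m hm k (by omega)
      refine ⟨s, hs.trans hmM, by simp [hsS, hs.ne], ?_⟩
      rwa [filter_insert, if_neg hs.not_gt]
    · have h1 : ∀ x ∈ insert m S, x < (m + M) / 2 := by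
        intro x hx
        rcases mem_insert.1 hx with rfl | hx
        · linarith
        · linarith [hm x hx]
      refine ⟨(m + M) / 2, by linarith, fun h => lt_irrefl _ (h1 _ h), ?_⟩
      rw [filter_true_of_mem h1, card_insert_of_notMem hmS]

theorem card_filter_lt_eq_iff {S : Finset ℝ} {s t : ℝ} (h : s ≤ t) :
    #{x ∈ S | x < s} = #{x ∈ S | x < t} ↔ ∀ x ∈ S, x < t → x < s := by
  have hsub : ({x ∈ S | x < s} : Finset ℝ) ⊆ {x ∈ S | x < t} := fun x hx => by
    rw [mem_filter] at hx ⊢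
    exact ⟨hx.1, hx.2.trans_le h⟩
  constructor
  · intro hc x hx hxt
    have := eq_of_subset_of_card_le hsub hc.ge
    have hx' : x ∈ ({x ∈ S | x < s} : Finset ℝ) := by
      rw [this]; exact mem_filter.2 ⟨hx, hxt⟩
    exact (mem_filter.1 hx').2
  · intro hx
    congr 1
    refine hsub.antisymm fun x hx' => ?_
    rw [mem_filter] at hx' ⊢
    exact ⟨hx'.1, hx x hx'.1 hx'.2⟩

section Line

variable {ι : Type*} {α β : ι → ℝ} {T : Finset ι} {S : Finset ℝ}

/-- Two points outside the zero set `S` of a family of affine functions on `ℝ` have the same sign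
pattern if and only if they have the same number of elements of `S` below them. -/
theorem realizes_iff_card_filter_lt (hS : ∀ s, s ∈ S ↔ ∃ i ∈ T, α i * s + β i = 0)
    {X : Finset ι} (hX : X ⊆ T) {s t : ℝ}
    (hs : Realizes (fun i s => α i * s + β i) T X s) :
    Realizes (fun i s => α i * s + β i) T X t ↔
      t ∉ S ∧ #{x ∈ S | x < t} = #{x ∈ S | x < s} := by
  classical
  have hsS : s ∉ S := fun h => by
    obtain ⟨i, hi, h0⟩ := (hS s).1 h
    exact hs.ne_zero hi h0
  -- a zero strictly between two points where an affine function takes opposite signs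
  have key : ∀ i ∈ T, ∀ u v : ℝ, α i * u + β i < 0 → 0 < α i * v + β i →
      ∃ x ∈ S, (u < x ∧ x < v) ∨ (v < x ∧ x < u) := by
    intro i hi u v hu hv
    have hα : α i ≠ 0 := by rintro h0; rw [h0] at hu hv; linarith
    have h0 : α i * (-β i / α i) + β i = 0 := by field_simp; ring
    refine ⟨-β i / α i, (hS _).2 ⟨i, hi, h0⟩, ?_⟩
    set x := -β i / α i
    rcases lt_or_gt_of_ne hα with h | h
    · right; constructor <;> nlinarith
    · left; constructor <;> nlinarith
  constructor
  · intro ht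
    have htS : t ∉ S := fun h => by
      obtain ⟨i, hi, h0⟩ := (hS t).1 h
      exact ht.ne_zero hi h0
    refine ⟨htS, ?_⟩
    -- the sign of an affine function cannot agree on both sides of one of its zeros
    have aux : ∀ u v : ℝ, Realizes (fun i s => α i * s + β i) T X u →
        Realizes (fun i s => α i * s + β i) T X v → v ∉ S → ∀ x ∈ S, x < v → x < u := by
      intro u v hu hv hvS x hx hxv
      by_contra hxu
      obtain ⟨i, hi, h0⟩ := (hS x).1 hx
      have hxu : u ≤ x := not_lt.1 hxu
      by_cases hiX : i ∈ X
      · have h1 : 0 < α i * u + β i := hu.1 i hiX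
        have h2 : 0 < α i * v + β i := hv.1 i hiX
        rcases le_or_gt (α i) 0 with h | h <;> nlinarith
      · have h1 : α i * u + β i < 0 := hu.2 i hi hiX
        have h2 : α i * v + β i < 0 := hv.2 i hi hiX
        rcases le_or_gt (α i) 0 with h | h <;> nlinarith
    rcases le_total t s with h | h
    · exact (card_filter_lt_eq_iff h).2 (aux t s ht hs hsS)
    · exact ((card_filter_lt_eq_iff h).2 (aux s t hs ht htS)).symm
  · rintro ⟨htS, hc⟩
    have hno : ∀ x ∈ S, ¬ (s < x ∧ x < t) ∧ ¬ (t < x ∧ x < s) := by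
      intro x hx
      rcases le_total t s with h | h
      · have := (card_filter_lt_eq_iff h).1 hc x hx
        exact ⟨fun h' => by linarith [h'.1, h'.2], fun h' => by linarith [this h'.2, h'.1]⟩
      · have := (card_filter_lt_eq_iff h).1 hc.symm x hx
        exact ⟨fun h' => by linarith [this h'.2, h'.1], fun h' => by linarith [h'.1, h'.2]⟩
    have ht0 : ∀ i ∈ T, α i * t + β i ≠ 0 := fun i hi h0 => htS ((hS t).2 ⟨i, hi, h0⟩)
    constructor
    · intro i hi
      by_contra hn
      obtain ⟨x, hx, h⟩ := key i (hX hi) t s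
        (lt_of_le_of_ne (not_lt.1 hn) (ht0 i (hX hi))) (hs.1 i hi)
      rcases h with h | h
      · exact (hno x hx).2 h
      · exact (hno x hx).1 h
    · intro i hi hiX
      by_contra hn
      obtain ⟨x, hx, h⟩ := key i hi s t (hs.2 i hi hiX)
        (lt_of_le_of_ne (not_lt.1 hn) (ht0 i hi).symm)
      rcases h with h | h
      · exact (hno x hx).1 h
      · exact (hno x hx).2 h

/-- The `k`-th gap of the finite zero set `S`, for `0 ≤ k ≤ #S`, realizes exactly one sign pattern,
different gaps realize different patterns, and every pattern arises in this way. -/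
theorem exists_patterns_eq_image [DecidableEq ι]
    (hS : ∀ s, s ∈ S ↔ ∃ i ∈ T, α i * s + β i = 0) :
    ∃ X : ℕ → Finset ι,
      patterns (fun i s => α i * s + β i) T Set.univ = (range (#S + 1)).image X ∧
      Set.InjOn X (range (#S + 1)) ∧
      ∀ k ∈ range (#S + 1), ∀ t, Realizes (fun i s => α i * s + β i) T (X k) t ↔
        t ∉ S ∧ #{x ∈ S | x < t} = k := by
  classical
  have hM : ∃ M : ℝ, ∀ x ∈ S, x < M := by
    obtain ⟨M, hM⟩ := S.bddAbove
    exact ⟨M + 1, fun x hx => by linarith [hM hx]⟩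
  obtain ⟨M, hM⟩ := hM
  have hex : ∀ k : ℕ, ∃ s, k ≤ #S → s ∉ S ∧ #{x ∈ S | x < s} = k := by
    intro k
    by_cases hk : k ≤ #S
    · obtain ⟨s, -, h⟩ := exists_card_filter_lt_eq S M hM k hk
      exact ⟨s, fun _ => h⟩
    · exact ⟨0, fun h => absurd h hk⟩
  choose c hc using hex
  have hreal : ∀ s ∉ S, Realizes (fun i s => α i * s + β i) T {i ∈ T | 0 < α i * s + β i} s :=
    fun s hs => realizes_filter (g := fun i s => α i * s + β i)
      fun i hi h0 => hs ((hS s).2 ⟨i, hi, h0⟩)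
  have hiff : ∀ k ∈ range (#S + 1), ∀ t,
      Realizes (fun i s => α i * s + β i) T {i ∈ T | 0 < α i * c k + β i} t ↔
        t ∉ S ∧ #{x ∈ S | x < t} = k := by
    intro k hk t
    have hk' := hc k (Nat.lt_succ_iff.1 (mem_range.1 hk))
    rw [realizes_iff_card_filter_lt hS (filter_subset _ _) (hreal _ hk'.1), hk'.2]
  refine ⟨fun k => {i ∈ T | 0 < α i * c k + β i}, ?_, ?_, hiff⟩
  · ext X
    rw [mem_patterns, mem_image]
    constructor
    · rintro ⟨hX, s, -, hs⟩
      have hk : #{x ∈ S | x < s} ∈ range (#S + 1) :=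
        mem_range.2 (Nat.lt_succ_iff.2 (card_filter_le _ _))
      refine ⟨_, hk, ?_⟩
      have hsS : s ∉ S := fun h => by
        obtain ⟨i, hi, h0⟩ := (hS s).1 h
        exact hs.ne_zero hi h0
      rw [Realizes.eq_filter hX hs]
      exact Realizes.eq_filter (filter_subset _ _) ((hiff _ hk s).2 ⟨hsS, rfl⟩)
    · rintro ⟨k, hk, rfl⟩
      exact ⟨filter_subset _ _, c k, trivial,
        hreal _ (hc k (Nat.lt_succ_iff.1 (mem_range.1 hk))).1⟩
  · intro k hk l hl h
    have hck := hc k (Nat.lt_succ_iff.1 (mem_range.1 hk))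
    have h1 := hreal _ hck.1
    dsimp only at h
    rw [h] at h1
    exact hck.2.symm.trans ((hiff l hl _).1 h1).2

theorem card_patterns_line (hS : ∀ s, s ∈ S ↔ ∃ i ∈ T, α i * s + β i = 0) :
    #(patterns (fun i s => α i * s + β i) T Set.univ) = #S + 1 := by
  classical
  obtain ⟨X, hX, hinj, -⟩ := exists_patterns_eq_image hS
  rw [hX, card_image_of_injOn hinj, card_range]

open Classical in
/-- All gaps of the zero set are bounded, except for the first one and the last one. -/
theorem card_bounded_patterns_line (hS : ∀ s, s ∈ S ↔ ∃ i ∈ T, α i * s + β i = 0)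
    (hne : S.Nonempty) :
    #{X ∈ patterns (fun i s => α i * s + β i) T Set.univ |
      Bornology.IsBounded {s | Realizes (fun i s => α i * s + β i) T X s}} = #S - 1 := by
  obtain ⟨X, hX, hinj, hiff⟩ := exists_patterns_eq_image hS
  have hset : ∀ k ∈ range (#S + 1), {s | Realizes (fun i s => α i * s + β i) T (X k) s} =
      {t | t ∉ S ∧ #{x ∈ S | x < t} = k} := fun k hk => Set.ext fun t => hiff k hk t
  have hb : ∀ k ∈ range (#S + 1),
      (Bornology.IsBounded {t : ℝ | t ∉ S ∧ #{x ∈ S | x < t} = k} ↔ k ∈ Ioo 0 #S) := by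
    intro k hk
    have hk' : k ≤ #S := Nat.lt_succ_iff.1 (mem_range.1 hk)
    constructor
    · intro hbd
      obtain ⟨B, hB⟩ := isBounded_iff_forall_norm_le.1 hbd
      rw [mem_Ioo]
      constructor
      · rcases Nat.eq_zero_or_pos k with rfl | h
        · exfalso
          set t := min (S.min' hne) (-|B|) - 1
          have h1 : ∀ x ∈ S, t < x := fun x hx => by
            have := S.min'_le x hx
            have := min_le_left (S.min' hne) (-|B|)
            simp only [t]; linarith
          have h2 := hB t ⟨fun h => lt_irrefl _ (h1 t h), by
            rw [card_eq_zero, filter_eq_empty_iff]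
            exact fun x hx => (h1 x hx).not_gt⟩
          have h3 : t < -|B| := by
            have := min_le_right (S.min' hne) (-|B|)
            simp only [t]; linarith
          rw [Real.norm_eq_abs] at h2
          linarith [neg_le_abs t, le_abs_self B]
        · exact h
      · rcases hk'.lt_or_eq with h | rfl
        · exact h
        · exfalso
          set t := max (S.max' hne) |B| + 1
          have h1 : ∀ x ∈ S, x < t := fun x hx => by
            have := S.le_max' x hx
            have := le_max_left (S.max' hne) |B|
            simp only [t]; linarith
          have h2 := hB t ⟨fun h => lt_irrefl _ (h1 t h), by
            rw [filter_true_of_mem h1]⟩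
          have h3 : |B| < t := by
            have := le_max_right (S.max' hne) |B|
            simp only [t]; linarith
          rw [Real.norm_eq_abs] at h2
          linarith [le_abs_self t, le_abs_self B]
    · intro h
      rw [mem_Ioo] at h
      refine (Metric.isBounded_Icc (S.min' hne) (S.max' hne)).subset ?_
      rintro t ⟨-, ht⟩
      constructor
      · by_contra hlt
        rw [not_le] at hlt
        have : #{x ∈ S | x < t} = 0 := by
          rw [card_eq_zero, filter_eq_empty_iff]
          exact fun x hx => by linarith [S.min'_le x hx]
        omega
      · by_contra hlt
        rw [not_le] at hlt
        have : #{x ∈ S | x < t} = #S := by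
          rw [filter_true_of_mem]
          exact fun x hx => by linarith [S.le_max' x hx]
        omega
  have : {X ∈ patterns (fun i s => α i * s + β i) T Set.univ |
      Bornology.IsBounded {s | Realizes (fun i s => α i * s + β i) T X s}} =
      (Ioo 0 #S).image X := by
    ext Y
    rw [hX, mem_filter, mem_image, mem_image]
    constructor
    · rintro ⟨⟨k, hk, rfl⟩, h⟩
      rw [hset k hk, hb k hk] at h
      exact ⟨k, h, rfl⟩
    · rintro ⟨k, hk, rfl⟩
      have hk' : k ∈ range (#S + 1) := by
        rw [mem_Ioo] at hk; rw [mem_range]; omega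
      exact ⟨⟨k, hk', rfl⟩, by rwa [hset k hk', hb k hk']⟩
  rw [this, card_image_of_injOn, Nat.card_Ioo, Nat.sub_zero]
  refine hinj.mono fun k hk => ?_
  rw [mem_coe, mem_Ioo] at hk
  rw [mem_coe, mem_range]
  omega

end Line

/-! ### Regions of an arrangement of non-vertical lines -/

/-- The signed vertical distance of the point `p` above the line `y = i.1 * x + i.2`. -/
def height (i p : ℝ × ℝ) : ℝ := p.2 - (i.1 * p.1 + i.2)

/-- The number of lines of `T` through the point `p`. -/
noncomputable def mult (T : Finset (ℝ × ℝ)) (p : ℝ × ℝ) : ℕ := #{i ∈ T | height i p = 0}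

theorem height_eq_zero_unique {i j p q : ℝ × ℝ} (hij : i ≠ j) (hi : height i p = 0)
    (hj : height j p = 0) (hi' : height i q = 0) (hj' : height j q = 0) : p = q := by
  simp only [height] at *
  have h : i.1 ≠ j.1 := by
    intro h
    apply hij
    ext
    · exact h
    · rw [h] at hi; linarith
  have h1 : (i.1 - j.1) * (p.1 - q.1) = 0 := by linear_combination hi' - hj' - hi + hj
  have h2 : p.1 = q.1 := by
    rcases mul_eq_zero.1 h1 with h' | h'
    · exact absurd (sub_eq_zero.1 h') h
    · exact sub_eq_zero.1 h'
  ext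
  · exact h2
  · rw [h2] at hi; linarith

theorem mult_mono {T T' : Finset (ℝ × ℝ)} (h : T ⊆ T') (p : ℝ × ℝ) : mult T p ≤ mult T' p :=
  card_le_card (filter_subset_filter _ h)

theorem two_le_mult_iff {T : Finset (ℝ × ℝ)} {p : ℝ × ℝ} :
    2 ≤ mult T p ↔ ∃ i ∈ T, ∃ j ∈ T, i ≠ j ∧ height i p = 0 ∧ height j p = 0 := by
  rw [mult, ← Nat.lt_iff_add_one_le, one_lt_card]
  simp only [mem_filter]
  constructor
  · rintro ⟨i, ⟨hi, hi0⟩, j, ⟨hj, hj0⟩, h⟩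
    exact ⟨i, hi, j, hj, h, hi0, hj0⟩
  · rintro ⟨i, hi, j, hj, h, hi0, hj0⟩
    exact ⟨i, ⟨hi, hi0⟩, j, ⟨hj, hj0⟩, h⟩

theorem finite_two_le_mult (T : Finset (ℝ × ℝ)) : {p | 2 ≤ mult T p}.Finite := by
  have : {p | 2 ≤ mult T p} ⊆ ⋃ ij ∈ {x ∈ T ×ˢ T | x.1 ≠ x.2},
      {p | height ij.1 p = 0 ∧ height ij.2 p = 0} := by
    intro p hp
    obtain ⟨i, hi, j, hj, hij, h⟩ := two_le_mult_iff.1 hp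
    simp only [Set.mem_iUnion]
    exact ⟨(i, j), mem_filter.2 ⟨mem_product.2 ⟨hi, hj⟩, hij⟩, h⟩
  refine (Set.Finite.biUnion (finite_toSet _) fun ij hij => ?_).subset this
  refine Set.Subsingleton.finite fun p hp q hq => ?_
  exact height_eq_zero_unique (mem_filter.1 (mem_coe.1 hij)).2 hp.1 hp.2 hq.1 hq.2

theorem continuous_height (i : ℝ × ℝ) : Continuous (height i) := by
  unfold height; fun_prop

theorem isOpen_realizes {T X : Finset (ℝ × ℝ)} : IsOpen {p | Realizes height T X p} := by
  have : {p | Realizes height T X p} =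
      (⋂ i ∈ X, {p | 0 < height i p}) ∩ ⋂ i ∈ T \ X, {p | height i p < 0} := by
    ext p
    simp [Realizes]
  rw [this]
  exact (isOpen_biInter_finset fun i _ => isOpen_lt continuous_const (continuous_height i)).inter
    (isOpen_biInter_finset fun i _ => isOpen_lt (continuous_height i) continuous_const)

theorem Realizes.exists_vertical_shift {T X : Finset (ℝ × ℝ)} {p : ℝ × ℝ}
    (h : Realizes height T X p) :
    ∃ ε > 0, Realizes height T X (p.1, p.2 + ε) ∧ Realizes height T X (p.1, p.2 - ε) := by
  obtain ⟨δ, hδ, hb⟩ := Metric.isOpen_iff.1 isOpen_realizes p h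
  refine ⟨δ / 2, by linarith, hb ?_, hb ?_⟩ <;>
    simp [Prod.dist_eq, abs_of_pos hδ, hδ]

theorem height_combination {i p q : ℝ × ℝ} {a b : ℝ} (hab : a + b = 1) :
    height i (a • p + b • q) = a * height i p + b * height i q := by
  simp only [height, Prod.fst_add, Prod.snd_add, Prod.smul_fst, Prod.smul_snd, smul_eq_mul]
  linear_combination i.2 * hab

theorem Realizes.convex {T X : Finset (ℝ × ℝ)} {p q : ℝ × ℝ} (hp : Realizes height T X p)
    (hq : Realizes height T X q) {a b : ℝ} (ha : 0 < a) (hb : 0 < b) (hab : a + b = 1) :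
    Realizes height T X (a • p + b • q) := by
  constructor
  · intro i hi
    rw [height_combination hab]
    have := mul_pos ha (hp.1 i hi)
    have := mul_pos hb (hq.1 i hi)
    linarith
  · intro i hi hiX
    rw [height_combination hab]
    have := mul_neg_of_pos_of_neg ha (hp.2 i hi hiX)
    have := mul_neg_of_pos_of_neg hb (hq.2 i hi hiX)
    linarith

/-- A new line `L` adds as many regions as there are old regions that it crosses: the old regions
are those that meet the upper or the lower side of `L`, and the crossed ones meet both. -/
theorem card_patterns_insert {T : Finset (ℝ × ℝ)} {L : ℝ × ℝ} (hL : L ∉ T) :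
    #(patterns height (insert L T) Set.univ) =
      #(patterns height T Set.univ) + #(patterns height T {p | height L p = 0}) := by
  classical
  set P := patterns height T {p | 0 < height L p}
  set N := patterns height T {p | height L p < 0}
  have hunion : patterns height T Set.univ = P ∪ N := by
    ext X
    simp only [P, N, mem_union, mem_patterns]
    constructor
    · rintro ⟨hX, p, -, hp⟩
      rcases lt_trichotomy (height L p) 0 with h | h | h
      · exact Or.inr ⟨hX, p, h, hp⟩
      · obtain ⟨ε, hε, h1, -⟩ := hp.exists_vertical_shift
        refine Or.inl ⟨hX, _, ?_, h1⟩
        simp only [height, Set.mem_ofPred_eq] at h ⊢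
        linarith
      · exact Or.inl ⟨hX, p, h, hp⟩
    · rintro (⟨hX, p, -, hp⟩ | ⟨hX, p, -, hp⟩) <;> exact ⟨hX, p, trivial, hp⟩
  have hinter : patterns height T {p | height L p = 0} = P ∩ N := by
    ext X
    simp only [P, N, mem_inter, mem_patterns]
    constructor
    · rintro ⟨hX, p, h, hp⟩
      obtain ⟨ε, hε, h1, h2⟩ := hp.exists_vertical_shift
      refine ⟨⟨hX, _, ?_, h1⟩, hX, _, ?_, h2⟩ <;>
      · simp only [height, Set.mem_ofPred_eq] at h ⊢
        linarith
    · rintro ⟨⟨hX, p, h, hp⟩, -, q, h', hq⟩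
      simp only [Set.mem_ofPred_eq] at h h'
      have hd : 0 < height L p - height L q := by linarith
      -- the point of the segment `[p, q]` on the line `L`
      refine ⟨hX, _, ?_, hp.convex hq (a := -height L q / (height L p - height L q))
        (b := height L p / (height L p - height L q)) (div_pos (by linarith) hd)
        (div_pos h hd) (by field_simp; ring)⟩
      rw [Set.mem_ofPred_eq, height_combination (by field_simp; ring)]
      field_simp
      ring
  have hsub : ∀ X ∈ P, L ∉ X := fun X hX h => hL ((mem_patterns.1 hX).1 h)
  have hsplit : patterns height (insert L T) Set.univ = P.image (insert L) ∪ N := by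
    ext X
    simp only [P, N, mem_union, mem_patterns, mem_image]
    constructor
    · rintro ⟨hX, p, -, hp⟩
      by_cases hLX : L ∈ X
      · refine Or.inl ⟨X.erase L, ⟨?_, p, hp.1 L hLX, ?_, ?_⟩, insert_erase hLX⟩
        · intro i hi
          exact (mem_insert.1 (hX (mem_of_mem_erase hi))).resolve_left (ne_of_mem_erase hi)
        · exact fun i hi => hp.1 i (mem_of_mem_erase hi)
        · intro i hi hiX
          refine hp.2 i (mem_insert_of_mem hi) fun h => hiX (mem_erase.2 ⟨?_, h⟩)
          rintro rfl
          exact hL hi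
      · refine Or.inr ⟨?_, p, hp.2 L (mem_insert_self _ _) hLX, hp.1, ?_⟩
        · intro i hi
          refine (mem_insert.1 (hX hi)).resolve_left ?_
          rintro rfl
          exact hLX hi
        · exact fun i hi => hp.2 i (mem_insert_of_mem hi)
    · rintro (⟨Y, ⟨hY, p, h, hp⟩, rfl⟩ | ⟨hX, p, h, hp⟩)
      · refine ⟨insert_subset_insert _ hY, p, trivial, ?_, ?_⟩
        · intro i hi
          rcases mem_insert.1 hi with rfl | hi
          · exact h
          · exact hp.1 i hi
        · intro i hi hiY
          rw [mem_insert, not_or] at hiY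
          exact hp.2 i ((mem_insert.1 hi).resolve_left hiY.1) hiY.2
      · refine ⟨hX.trans (subset_insert _ _), p, trivial, hp.1, ?_⟩
        intro i hi hiX
        rcases mem_insert.1 hi with rfl | hi
        · exact h
        · exact hp.2 i hi hiX
  have hdisj : Disjoint (P.image (insert L)) N := by
    rw [disjoint_left]
    intro X hX hXN
    obtain ⟨Y, -, rfl⟩ := mem_image.1 hX
    exact hL ((mem_patterns.1 hXN).1 (mem_insert_self _ _))
  have hinj : Set.InjOn (insert L) (P : Set (Finset (ℝ × ℝ))) := by
    intro X hX Y hY h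
    rw [← erase_insert (hsub X hX), h, erase_insert (hsub Y hY)]
  rw [hsplit, card_union_of_disjoint hdisj, card_image_of_injOn hinj, hunion, hinter,
    card_union_add_card_inter]

/-- The points in which the other lines meet the line `L`, parametrized by their abscissa. -/
theorem mem_image_fst_filter_iff {T V : Finset (ℝ × ℝ)} {L : ℝ × ℝ} (hL : L ∉ T)
    (hV : ∀ p, 2 ≤ mult (insert L T) p → p ∈ V) (s : ℝ) :
    s ∈ ({p ∈ V | height L p = 0 ∧ ∃ i ∈ T, height i p = 0} : Finset (ℝ × ℝ)).image Prod.fst ↔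
      ∃ i ∈ T, (L.1 - i.1) * s + (L.2 - i.2) = 0 := by
  classical
  simp only [mem_image, mem_filter]
  constructor
  · rintro ⟨p, ⟨-, h0, i, hi, h⟩, rfl⟩
    refine ⟨i, hi, ?_⟩
    simp only [height] at h h0
    linarith
  · rintro ⟨i, hi, h⟩
    have h0 : height L (s, L.1 * s + L.2) = 0 := by simp [height]
    have h1 : height i (s, L.1 * s + L.2) = 0 := by simp only [height]; linarith
    refine ⟨(s, L.1 * s + L.2), ⟨hV _ (two_le_mult_iff.2 ?_), h0, i, hi, h1⟩, rfl⟩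
    refine ⟨L, mem_insert_self _ _, i, mem_insert_of_mem hi, ?_, h0, h1⟩
    rintro rfl
    exact hL hi

theorem card_image_fst_filter {V : Finset (ℝ × ℝ)} {L : ℝ × ℝ} (Q : ℝ × ℝ → Prop)
    [DecidablePred Q] :
    #(({p ∈ V | height L p = 0 ∧ Q p} : Finset (ℝ × ℝ)).image Prod.fst) =
      #{p ∈ V | height L p = 0 ∧ Q p} := by
  refine card_image_of_injOn fun p hp q hq h => ?_
  have hp := (mem_filter.1 (mem_coe.1 hp)).2.1
  have hq := (mem_filter.1 (mem_coe.1 hq)).2.1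
  simp only [height] at hp hq
  ext
  · exact h
  · rw [h] at hp; linarith

theorem realizes_line_iff {T X : Finset (ℝ × ℝ)} {L p : ℝ × ℝ} (hp : height L p = 0) :
    Realizes height T X p ↔
      Realizes (fun i s => (L.1 - i.1) * s + (L.2 - i.2)) T X p.1 := by
  have : ∀ i, height i p = (L.1 - i.1) * p.1 + (L.2 - i.2) := by
    intro i
    simp only [height] at hp ⊢
    linarith
  simp only [Realizes, this]

theorem patterns_line_eq {T : Finset (ℝ × ℝ)} {L : ℝ × ℝ} :
    patterns height T {p | height L p = 0} =
      patterns (fun i s => (L.1 - i.1) * s + (L.2 - i.2)) T Set.univ := by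
  ext X
  rw [mem_patterns, mem_patterns]
  refine and_congr_right fun _ => ⟨?_, ?_⟩
  · rintro ⟨p, h, hp⟩
    exact ⟨p.1, trivial, (realizes_line_iff h).1 hp⟩
  · rintro ⟨s, -, hs⟩
    have h0 : height L (s, L.1 * s + L.2) = 0 := by simp [height]
    exact ⟨_, h0, (realizes_line_iff h0).2 hs⟩

/-- The number of regions of an arrangement of lines, in terms of the multiplicities of its
vertices. -/
theorem card_patterns_univ (V T : Finset (ℝ × ℝ)) (hV : ∀ p, 2 ≤ mult T p → p ∈ V) :
    #(patterns height T Set.univ) = 1 + #T + ∑ p ∈ V, (mult T p - 1) := by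
  classical
  induction T using Finset.induction_on with
  | empty =>
    have : patterns height ∅ (Set.univ : Set (ℝ × ℝ)) = {∅} := by
      ext X
      rw [mem_patterns, subset_empty, mem_singleton]
      refine ⟨And.left, ?_⟩
      rintro rfl
      exact ⟨rfl, (0, 0), trivial, by simp [Realizes]⟩
    rw [this]
    simp [mult]
  | insert L T hL ih =>
    have hV' : ∀ p, 2 ≤ mult T p → p ∈ V := fun p hp =>
      hV p (hp.trans (mult_mono (subset_insert _ _) p))
    rw [card_patterns_insert hL, ih hV', patterns_line_eq,
      card_patterns_line (mem_image_fst_filter_iff hL hV), card_image_fst_filter,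
      card_insert_of_notMem hL]
    have hsum : ∑ p ∈ V, (mult (insert L T) p - 1) = ∑ p ∈ V, (mult T p - 1) +
        #{p ∈ V | height L p = 0 ∧ ∃ i ∈ T, height i p = 0} := by
      rw [card_filter, ← sum_add_distrib]
      refine sum_congr rfl fun p _ => ?_
      have hpos : (∃ i ∈ T, height i p = 0) ↔ 0 < mult T p := by
        rw [mult, card_pos, filter_nonempty_iff]
      simp only [hpos]
      have hins : mult (insert L T) p = mult T p + if height L p = 0 then 1 else 0 := by
        unfold mult
        rw [filter_insert]
        split_ifs
        · rw [card_insert_of_notMem fun h => hL (mem_filter.1 h).1]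
        · rfl
      rw [hins]
      split_ifs <;> first | omega | simp_all
    rw [hsum]
    ring

/-! ### Bounded regions -/

theorem isBounded_iff_exists_abs_le {C : Set (ℝ × ℝ)} :
    Bornology.IsBounded C ↔ ∃ B, ∀ p ∈ C, |p.1| ≤ B ∧ |p.2| ≤ B := by
  simp only [isBounded_iff_forall_norm_le, Prod.norm_def, Real.norm_eq_abs, max_le_iff]

/-- The ordinate at abscissa `s` of the line `y = i.1 * x + i.2`. -/
def ordinate (i : ℝ × ℝ) (s : ℝ) : ℝ := i.1 * s + i.2

theorem eventually_atTop_ordinate_lt_iff (i j : ℝ × ℝ) :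
    ∀ᶠ s in atTop, (ordinate i s < ordinate j s ↔ i.1 < j.1 ∨ i.1 = j.1 ∧ i.2 < j.2) := by
  have key : ∀ a b : ℝ, 0 < a → ∀ᶠ s in atTop, 0 < a * s + b := fun a b ha =>
    (tendsto_atTop_add_const_right _ b (tendsto_id.const_mul_atTop ha)).eventually_gt_atTop 0
  rcases lt_trichotomy i.1 j.1 with h | h | h
  · filter_upwards [key (j.1 - i.1) (j.2 - i.2) (by linarith)] with s hs
    refine iff_of_true ?_ (Or.inl h)
    simp only [ordinate]; linarith
  · refine Eventually.of_forall fun s => ?_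
    simp [ordinate, h]
  · filter_upwards [key (i.1 - j.1) (i.2 - j.2) (by linarith)] with s hs
    refine iff_of_false ?_ ?_
    · simp only [ordinate]; linarith
    · rintro (h' | ⟨h', -⟩) <;> linarith

theorem eventually_atBot_ordinate_lt_iff (i j : ℝ × ℝ) :
    ∀ᶠ s in atBot, (ordinate i s < ordinate j s ↔ j.1 < i.1 ∨ i.1 = j.1 ∧ i.2 < j.2) := by
  have h := tendsto_neg_atBot_atTop.eventually
    (eventually_atTop_ordinate_lt_iff (-i.1, i.2) (-j.1, j.2))
  filter_upwards [h] with s hs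
  simpa [ordinate] using hs

theorem realizes_iff_ordinate {T X : Finset (ℝ × ℝ)} {p : ℝ × ℝ} :
    Realizes height T X p ↔
      (∀ i ∈ X, ordinate i p.1 < p.2) ∧ ∀ i ∈ T, i ∉ X → p.2 < ordinate i p.1 := by
  simp only [Realizes, height, ordinate, sub_pos, sub_neg]

/-- A sign pattern realized on the vertical line `x = s` is realized on every vertical line on which
the lines of `T` appear in the same order. -/
theorem Realizes.transfer {T X : Finset (ℝ × ℝ)} (hX : X ⊆ T) {s s' : ℝ}
    (hord : ∀ i ∈ T, ∀ j ∈ T, ordinate i s < ordinate j s → ordinate i s' < ordinate j s')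
    {t : ℝ} (h : Realizes height T X (s, t)) : ∃ t', Realizes height T X (s', t') := by
  classical
  rw [realizes_iff_ordinate] at h
  obtain ⟨t', h1, h2⟩ := Order.exists_between_finsets (X.image fun i => ordinate i s')
    ((T \ X).image fun i => ordinate i s') (by
      simp only [mem_image, Finset.mem_sdiff]
      rintro _ ⟨i, hi, rfl⟩ _ ⟨j, ⟨hj, hjX⟩, rfl⟩
      exact hord i (hX hi) j hj ((h.1 i hi).trans (h.2 j hj hjX)))
  refine ⟨t', realizes_iff_ordinate.2 ⟨fun i hi => h1 _ (mem_image_of_mem _ hi), ?_⟩⟩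
  exact fun i hi hiX => h2 _ (mem_image_of_mem _ (Finset.mem_sdiff.2 ⟨hi, hiX⟩))

theorem card_patterns_vertical {T : Finset (ℝ × ℝ)} {s : ℝ}
    (hinj : Set.InjOn (fun i => ordinate i s) (T : Set (ℝ × ℝ))) :
    #(patterns height T {p | p.1 = s}) = #T + 1 := by
  classical
  have h : patterns height T {p | p.1 = s} =
      patterns (fun (i : ℝ × ℝ) t => 1 * t + -ordinate i s) T Set.univ := by
    ext X
    rw [mem_patterns, mem_patterns]
    refine and_congr_right fun _ => ⟨?_, ?_⟩
    · rintro ⟨p, rfl, hp⟩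
      refine ⟨p.2, trivial, ?_⟩
      simpa only [Realizes, height, ordinate, one_mul, ← sub_eq_add_neg] using hp
    · rintro ⟨t, -, ht⟩
      refine ⟨(s, t), rfl, ?_⟩
      simpa only [Realizes, height, ordinate, one_mul, ← sub_eq_add_neg] using ht
  rw [h, card_patterns_line (S := T.image fun i => ordinate i s), card_image_of_injOn hinj]
  intro t
  simp only [mem_image, one_mul, ← sub_eq_add_neg, sub_eq_zero, eq_comm]

open Classical in
/-- The number of bounded regions. A region is unbounded if and only if it meets one of two vertical
lines to the left and to the right of all vertices. Each of them meets one region more than there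
are lines, and only the bottom and the top region meet both. -/
theorem card_bounded_patterns (V T : Finset (ℝ × ℝ)) (hV : ∀ p, 2 ≤ mult T p → p ∈ V)
    (hpar : ∃ i ∈ T, ∃ j ∈ T, i.1 ≠ j.1) :
    #{X ∈ patterns height T Set.univ | Bornology.IsBounded {p | Realizes height T X p}} + #T =
      1 + ∑ p ∈ V, (mult T p - 1) := by
  have hR : ∃ s₁, ∀ s ≥ s₁, ∀ i ∈ T, ∀ j ∈ T,
      (ordinate i s < ordinate j s ↔ i.1 < j.1 ∨ i.1 = j.1 ∧ i.2 < j.2) :=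
    eventually_atTop.1 ((eventually_all_finset T).2 fun i _ => (eventually_all_finset T).2
      fun j _ => eventually_atTop_ordinate_lt_iff i j)
  have hL : ∃ s₀, ∀ s ≤ s₀, ∀ i ∈ T, ∀ j ∈ T,
      (ordinate i s < ordinate j s ↔ j.1 < i.1 ∨ i.1 = j.1 ∧ i.2 < j.2) :=
    eventually_atBot.1 ((eventually_all_finset T).2 fun i _ => (eventually_all_finset T).2
      fun j _ => eventually_atBot_ordinate_lt_iff i j)
  obtain ⟨s₁, hR⟩ := hR
  obtain ⟨s₀, hL⟩ := hL
  set P₁ := patterns height T {p | p.1 = s₁}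
  set P₀ := patterns height T {p | p.1 = s₀}
  have hTne : T.Nonempty := let ⟨i, hi, _⟩ := hpar; ⟨i, hi⟩
  have hc₁ : #P₁ = #T + 1 := by
    refine card_patterns_vertical fun i hi j hj h => ?_
    have h1 := hR s₁ le_rfl i hi j hj
    have h2 := hR s₁ le_rfl j hj i hi
    rcases lt_trichotomy i.1 j.1 with h' | h' | h'
    · exact absurd (h1.2 (Or.inl h')) (by simpa using h.ge)
    · ext
      · exact h'
      · simpa [ordinate, h'] using h
    · exact absurd (h2.2 (Or.inl h')) (by simpa using h.le)
  have hc₀ : #P₀ = #T + 1 := by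
    refine card_patterns_vertical fun i hi j hj h => ?_
    have h1 := hL s₀ le_rfl i hi j hj
    have h2 := hL s₀ le_rfl j hj i hi
    rcases lt_trichotomy i.1 j.1 with h' | h' | h'
    · exact absurd (h2.2 (Or.inl h')) (by simpa using h.le)
    · ext
      · exact h'
      · simpa [ordinate, h'] using h
    · exact absurd (h1.2 (Or.inl h')) (by simpa using h.ge)
  have hext : ∀ s, ∅ ∈ patterns height T {p | p.1 = s} ∧ T ∈ patterns height T {p | p.1 = s} := by
    intro s
    obtain ⟨b, hb⟩ := (T.image fun i => ordinate i s).bddBelow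
    obtain ⟨c, hc⟩ := (T.image fun i => ordinate i s).bddAbove
    constructor
    · refine mem_patterns.2 ⟨empty_subset _, (s, b - 1), rfl, realizes_iff_ordinate.2
        ⟨by simp, fun i hi _ => ?_⟩⟩
      have : b ≤ ordinate i s := hb (mem_coe.2 (mem_image_of_mem _ hi))
      simp only
      linarith
    · refine mem_patterns.2 ⟨Subset.rfl, (s, c + 1), rfl, realizes_iff_ordinate.2
        ⟨fun i hi => ?_, fun i hi h => absurd hi h⟩⟩
      have : ordinate i s ≤ c := hc (mem_coe.2 (mem_image_of_mem _ hi))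
      simp only
      linarith
  have hinter : P₀ ∩ P₁ = {∅, T} := by
    ext X
    simp only [mem_inter, mem_insert, mem_singleton]
    constructor
    · rintro ⟨h0, h1⟩
      obtain ⟨hX, ⟨_, t⟩, rfl, hp⟩ := mem_patterns.1 h0
      obtain ⟨-, ⟨_, u⟩, rfl, hq⟩ := mem_patterns.1 h1
      rw [realizes_iff_ordinate] at hp hq
      -- a line below the region and a line above it keep their order from left to right
      have hslope : ∀ i ∈ X, ∀ j ∈ T, j ∉ X → i.1 = j.1 := by
        intro i hi j hj hjX
        have a := (hL _ le_rfl i (hX hi) j hj).1 ((hp.1 i hi).trans (hp.2 j hj hjX))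
        have b := (hR _ le_rfl i (hX hi) j hj).1 ((hq.1 i hi).trans (hq.2 j hj hjX))
        rcases a with a | a
        · rcases b with b | b
          · exact absurd a b.not_gt
          · exact b.1
        · exact a.1
      by_contra hn
      rw [not_or] at hn
      obtain ⟨i₀, hi₀⟩ := nonempty_iff_ne_empty.2 hn.1
      obtain ⟨j₀, hj₀, hj₀X⟩ : ∃ j ∈ T, j ∉ X := by
        by_contra! h
        exact hn.2 (hX.antisymm h)
      have hall : ∀ i ∈ T, i.1 = i₀.1 := by
        intro i hi
        by_cases hiX : i ∈ X
        · rw [hslope i hiX j₀ hj₀ hj₀X, hslope i₀ hi₀ j₀ hj₀ hj₀X]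
        · exact (hslope i₀ hi₀ i hi hiX).symm
      obtain ⟨i, hi, j, hj, hij⟩ := hpar
      exact hij ((hall i hi).trans (hall j hj).symm)
    · rintro (rfl | rfl)
      · exact ⟨(hext _).1, (hext _).1⟩
      · exact ⟨(hext _).2, (hext _).2⟩
  have hunion : #(P₀ ∪ P₁) = 2 * #T := by
    have h1 := card_union_add_card_inter P₀ P₁
    rw [hinter, card_pair hTne.ne_empty.symm] at h1
    omega
  have hsub : P₀ ∪ P₁ ⊆ patterns height T Set.univ := by
    intro X hX
    rcases mem_union.1 hX with h | h <;> obtain ⟨hX, p, -, hp⟩ := mem_patterns.1 h <;>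
      exact mem_patterns.2 ⟨hX, p, trivial, hp⟩
  have hbdd : {X ∈ patterns height T Set.univ | Bornology.IsBounded {p | Realizes height T X p}} =
      patterns height T Set.univ \ (P₀ ∪ P₁) := by
    ext X
    rw [mem_filter, Finset.mem_sdiff]
    refine and_congr_right fun hXr => ?_
    have hX := (mem_patterns.1 hXr).1
    constructor
    · intro hb hmem
      obtain ⟨B, hB⟩ := isBounded_iff_exists_abs_le.1 hb
      rcases mem_union.1 hmem with h | h
      · obtain ⟨-, ⟨x, t⟩, hx, hp⟩ := mem_patterns.1 h
        obtain rfl : x = s₀ := hx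
        set s := min x (-|B| - 1)
        obtain ⟨t', ht'⟩ := hp.transfer hX (s' := s) fun i hi j hj hij =>
          (hL s (min_le_left _ _) i hi j hj).2 ((hL _ le_rfl i hi j hj).1 hij)
        have h1 := (hB _ ht').1
        have h2 : s ≤ -|B| - 1 := min_le_right _ _
        have h3 := neg_le_abs s
        have h4 := le_abs_self B
        simp only at h1
        linarith
      · obtain ⟨-, ⟨x, t⟩, hx, hp⟩ := mem_patterns.1 h
        obtain rfl : x = s₁ := hx
        set s := max x (|B| + 1)
        obtain ⟨t', ht'⟩ := hp.transfer hX (s' := s) fun i hi j hj hij =>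
          (hR s (le_max_left _ _) i hi j hj).2 ((hR _ le_rfl i hi j hj).1 hij)
        have h1 := (hB _ ht').1
        have h2 : |B| + 1 ≤ s := le_max_right _ _
        have h3 := le_abs_self s
        have h4 := le_abs_self B
        simp only at h1
        linarith
    · intro hmem
      rw [mem_union, not_or] at hmem
      have hne : X.Nonempty := by
        rw [nonempty_iff_ne_empty]
        rintro rfl
        exact hmem.1 (hext _).1
      obtain ⟨i, hi⟩ := hne
      obtain ⟨j, hj, hjX⟩ : ∃ j ∈ T, j ∉ X := by
        by_contra! h
        rw [hX.antisymm h] at hmem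
        exact hmem.1 (hext _).2
      set B := max |s₀| |s₁|
      refine isBounded_iff_exists_abs_le.2
        ⟨max B (max (|i.1| * B + |i.2|) (|j.1| * B + |j.2|)), ?_⟩
      rintro ⟨s, t⟩ hp
      have hs₀ : s₀ ≤ s := by
        by_contra! h
        obtain ⟨t', ht'⟩ := Realizes.transfer hX (s' := s₀) (fun i hi j hj hij =>
          (hL s₀ le_rfl i hi j hj).2 ((hL s h.le i hi j hj).1 hij)) hp
        exact hmem.1 (mem_patterns.2 ⟨hX, _, rfl, ht'⟩)
      have hs₁ : s ≤ s₁ := by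
        by_contra! h
        obtain ⟨t', ht'⟩ := Realizes.transfer hX (s' := s₁) (fun i hi j hj hij =>
          (hR s₁ le_rfl i hi j hj).2 ((hR s h.le i hi j hj).1 hij)) hp
        exact hmem.2 (mem_patterns.2 ⟨hX, _, rfl, ht'⟩)
      have hs : |s| ≤ B := abs_le_max_abs_abs hs₀ hs₁
      have hord : ∀ k : ℝ × ℝ, |ordinate k s| ≤ |k.1| * B + |k.2| := by
        intro k
        refine (abs_add_le _ _).trans ?_
        rw [abs_mul]
        gcongr
      have hp' := realizes_iff_ordinate.1 hp
      refine ⟨hs.trans (le_max_left _ _), ?_⟩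
      refine (abs_le_max_abs_abs (hp'.1 i hi).le (hp'.2 j hj hjX).le).trans ?_
      exact (max_le_max (hord i) (hord j)).trans (le_max_right _ _)
  have hsd := card_sdiff_add_card_eq_card hsub
  rw [← hbdd, hunion, card_patterns_univ V T hV] at hsd
  omega

/-! ### Bounded edges -/

open Classical in
/-- A line `L` that is not parallel to all other lines has one bounded edge less than it has
vertices. -/
theorem card_bounded_edge_patterns {V T : Finset (ℝ × ℝ)} (hV : ∀ p, p ∈ V ↔ 2 ≤ mult T p)
    {L : ℝ × ℝ} (hL : L ∈ T) (hne : ∃ i ∈ T, i.1 ≠ L.1) :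
    #{X ∈ patterns height (T.erase L) {p | height L p = 0} |
      Bornology.IsBounded {p | height L p = 0 ∧ Realizes height (T.erase L) X p}} + 1 =
      #{p ∈ V | height L p = 0} := by
  have hLT : L ∉ T.erase L := notMem_erase L T
  have hS := mem_image_fst_filter_iff hLT (V := V)
    (by rw [insert_erase hL]; exact fun p hp => (hV p).2 hp)
  have hbd : ∀ X, Bornology.IsBounded {p | height L p = 0 ∧ Realizes height (T.erase L) X p} ↔
      Bornology.IsBounded
        {s | Realizes (fun i s => (L.1 - i.1) * s + (L.2 - i.2)) (T.erase L) X s} := by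
    intro X
    rw [isBounded_iff_exists_abs_le, isBounded_iff_forall_norm_le]
    constructor
    · rintro ⟨B, hB⟩
      refine ⟨B, fun s hs => ?_⟩
      have h0 : height L (s, L.1 * s + L.2) = 0 := by simp [height]
      exact (hB _ ⟨h0, (realizes_line_iff h0).2 hs⟩).1
    · rintro ⟨B, hB⟩
      refine ⟨max B (|L.1| * B + |L.2|), fun p ⟨h0, hp⟩ => ?_⟩
      have h1 : |p.1| ≤ B := hB _ ((realizes_line_iff h0).1 hp)
      refine ⟨h1.trans (le_max_left _ _), ?_⟩
      have h2 : p.2 = L.1 * p.1 + L.2 := sub_eq_zero.1 h0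
      rw [h2]
      refine ((abs_add_le _ _).trans ?_).trans (le_max_right _ _)
      rw [abs_mul]
      gcongr
  have hfilter : ({p ∈ V | height L p = 0 ∧ ∃ i ∈ T.erase L, height i p = 0} : Finset (ℝ × ℝ)) =
      {p ∈ V | height L p = 0} := by
    refine filter_congr fun p hp => ⟨And.left, fun h => ⟨h, ?_⟩⟩
    obtain ⟨i, hi, j, hj, hij, hi0, hj0⟩ := two_le_mult_iff.1 ((hV p).1 hp)
    by_cases hiL : i = L
    · exact ⟨j, mem_erase.2 ⟨fun h => hij (hiL.trans h.symm), hj⟩, hj0⟩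
    · exact ⟨i, mem_erase.2 ⟨hiL, hi⟩, hi0⟩
  have hnonempty : (({p ∈ V | height L p = 0 ∧ ∃ i ∈ T.erase L, height i p = 0} :
      Finset (ℝ × ℝ)).image Prod.fst).Nonempty := by
    obtain ⟨i, hi, hiL⟩ := hne
    have hsub : L.1 - i.1 ≠ 0 := sub_ne_zero.2 hiL.symm
    refine ⟨-(L.2 - i.2) / (L.1 - i.1), (hS _).2 ⟨i, mem_erase.2 ⟨?_, hi⟩, ?_⟩⟩
    · rintro rfl
      exact hiL rfl
    · field_simp
      ring
  simp only [hbd]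
  rw [patterns_line_eq, card_bounded_patterns_line hS hnonempty,
    Nat.sub_add_cancel (card_pos.2 hnonempty), card_image_fst_filter, hfilter]

open Classical in
/-- The total number of bounded edges, by counting the pairs of a line and a vertex on it in two
ways. -/
theorem sum_card_bounded_edge_patterns {V T : Finset (ℝ × ℝ)} (hV : ∀ p, p ∈ V ↔ 2 ≤ mult T p)
    (hpar : ∃ i ∈ T, ∃ j ∈ T, i.1 ≠ j.1) :
    ∑ L ∈ T, #{X ∈ patterns height (T.erase L) {p | height L p = 0} |
      Bornology.IsBounded {p | height L p = 0 ∧ Realizes height (T.erase L) X p}} + #T =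
      ∑ p ∈ V, mult T p := by
  have hne : ∀ L ∈ T, ∃ i ∈ T, i.1 ≠ L.1 := by
    intro L _
    obtain ⟨i, hi, j, hj, hij⟩ := hpar
    by_cases h : i.1 = L.1
    · exact ⟨j, hj, fun h' => hij (h.trans h'.symm)⟩
    · exact ⟨i, hi, h⟩
  rw [card_eq_sum_ones, ← sum_add_distrib,
    sum_congr rfl fun L hL => card_bounded_edge_patterns hV hL (hne L hL)]
  simp only [mult, card_filter]
  exact sum_comm

/-! ### Cells as sign classes -/

/-- The cell of the point `p`, in the arrangement of the lines `y = i.1 * x + i.2` with `i ∈ T`: the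
points at which all the heights have the same signs as at `p`. -/
def signCell (T : Finset (ℝ × ℝ)) (p : ℝ × ℝ) : Set (ℝ × ℝ) :=
  {q | ∀ i ∈ T, SignType.sign (height i q) = SignType.sign (height i p)}

theorem mem_signCell_self (T : Finset (ℝ × ℝ)) (p : ℝ × ℝ) : p ∈ signCell T p := fun _ _ => rfl

theorem Realizes.realizes_iff_sign_eq {T X : Finset (ℝ × ℝ)} (hX : X ⊆ T) {p q : ℝ × ℝ}
    (hp : Realizes height T X p) :
    Realizes height T X q ↔
      ∀ i ∈ T, SignType.sign (height i q) = SignType.sign (height i p) := by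
  constructor
  · intro hq i hi
    by_cases hiX : i ∈ X
    · rw [sign_pos (hq.1 i hiX), sign_pos (hp.1 i hiX)]
    · rw [sign_neg (hq.2 i hi hiX), sign_neg (hp.2 i hi hiX)]
  · intro h
    refine ⟨fun i hi => ?_, fun i hi hiX => ?_⟩
    · rw [← sign_eq_one_iff, h i (hX hi), sign_eq_one_iff]
      exact hp.1 i hi
    · rw [← sign_eq_neg_one_iff, h i hi, sign_eq_neg_one_iff]
      exact hp.2 i hi hiX

theorem signCell_eq_face {T X : Finset (ℝ × ℝ)} (hX : X ⊆ T) {p : ℝ × ℝ}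
    (hp : Realizes height T X p) : signCell T p = {q | Realizes height T X q} :=
  Set.ext fun _ => (hp.realizes_iff_sign_eq hX).symm

theorem signCell_eq_edge {T X : Finset (ℝ × ℝ)} {L : ℝ × ℝ} (hL : L ∈ T) (hX : X ⊆ T.erase L)
    {p : ℝ × ℝ} (h0 : height L p = 0) (hp : Realizes height (T.erase L) X p) :
    signCell T p = {q | height L q = 0 ∧ Realizes height (T.erase L) X q} := by
  ext q
  rw [Set.mem_ofPred_eq, hp.realizes_iff_sign_eq hX]
  constructor
  · intro h
    refine ⟨?_, fun i hi => h i (mem_of_mem_erase hi)⟩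
    have := h L hL
    rwa [h0, sign_zero, sign_eq_zero_iff] at this
  · rintro ⟨hq, h⟩ i hi
    by_cases hiL : i = L
    · rw [hiL, hq, h0]
    · exact h i (mem_erase.2 ⟨hiL, hi⟩)

theorem finrank_vectorSpan_face {T X : Finset (ℝ × ℝ)} {p : ℝ × ℝ}
    (hp : Realizes height T X p) :
    Module.finrank ℝ (vectorSpan ℝ {q | Realizes height T X q}) = 2 := by
  rw [← direction_affineSpan, isOpen_realizes.affineSpan_eq_top ⟨p, hp⟩,
    AffineSubspace.direction_top, finrank_top, Module.finrank_prod, Module.finrank_self]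

theorem finrank_vectorSpan_edge {T X : Finset (ℝ × ℝ)} {L p : ℝ × ℝ} (h0 : height L p = 0)
    (hp : Realizes height T X p) :
    Module.finrank ℝ (vectorSpan ℝ {q | height L q = 0 ∧ Realizes height T X q}) = 1 := by
  have h : vectorSpan ℝ {q | height L q = 0 ∧ Realizes height T X q} =
      Submodule.span ℝ {((1 : ℝ), L.1)} := by
    apply le_antisymm
    · rw [vectorSpan_def, Submodule.span_le]
      rintro _ ⟨q, ⟨hq, -⟩, r, ⟨hr, -⟩, rfl⟩
      refine Submodule.mem_span_singleton.2 ⟨q.1 - r.1, ?_⟩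
      simp only [height] at hq hr
      ext
      · simp
      · simp only [Prod.smul_snd, smul_eq_mul, vsub_eq_sub, Prod.snd_sub]
        linarith
    · rw [Submodule.span_singleton_le_iff_mem]
      -- the cell is relatively open in the line, so it contains a second point `p + ε (1, L.1)`
      have hcont : Continuous fun ε : ℝ => p + ε • ((1 : ℝ), L.1) := by fun_prop
      have hopen : IsOpen {ε : ℝ | Realizes height T X (p + ε • ((1 : ℝ), L.1))} :=
        isOpen_realizes.preimage hcont
      obtain ⟨δ, hδ, hb⟩ := Metric.isOpen_iff.1 hopen 0
        (by rwa [Set.mem_ofPred_eq, zero_smul, add_zero])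
      have hq : Realizes height T X (p + (δ / 2) • ((1 : ℝ), L.1)) :=
        hb (by simp [abs_of_pos hδ, hδ])
      have hq0 : height L (p + (δ / 2) • ((1 : ℝ), L.1)) = 0 := by
        simp only [height, Prod.fst_add, Prod.snd_add, Prod.smul_fst, Prod.smul_snd,
          smul_eq_mul] at h0 ⊢
        linarith
      have := vsub_mem_vectorSpan ℝ
        (s := {q | height L q = 0 ∧ Realizes height T X q}) ⟨hq0, hq⟩ ⟨h0, hp⟩
      rw [vsub_eq_sub, add_sub_cancel_left] at this
      exact (Submodule.smul_mem_iff _ (by positivity)).1 this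
  rw [h, finrank_span_singleton]
  intro h'
  exact one_ne_zero (congrArg Prod.fst h')

theorem finrank_vectorSpan_vertex {T : Finset (ℝ × ℝ)} {p : ℝ × ℝ} (h : 2 ≤ mult T p) :
    Module.finrank ℝ (vectorSpan ℝ (signCell T p)) = 0 := by
  obtain ⟨i, hi, j, hj, hij, hi0, hj0⟩ := two_le_mult_iff.1 h
  have hz : ∀ q ∈ signCell T p, ∀ k ∈ T, height k p = 0 → height k q = 0 := by
    intro q hq k hk h0
    have := hq k hk
    rwa [h0, sign_zero, sign_eq_zero_iff] at this
  have : signCell T p = {p} := by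
    refine Set.eq_singleton_iff_unique_mem.2 ⟨mem_signCell_self T p, fun q hq => ?_⟩
    exact height_eq_zero_unique hij (hz q hq i hi hi0) (hz q hq j hj hj0) hi0 hj0
  rw [this, vectorSpan_singleton, finrank_bot]

/-- The three kinds of cells. -/
theorem signCell_cases (T : Finset (ℝ × ℝ)) (p : ℝ × ℝ) :
    (∃ X ⊆ T, Realizes height T X p) ∨
    (∃ L ∈ T, ∃ X ⊆ T.erase L, height L p = 0 ∧ Realizes height (T.erase L) X p) ∨
    2 ≤ mult T p := by
  classical
  by_cases h : ∀ i ∈ T, height i p ≠ 0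
  · exact Or.inl ⟨_, filter_subset _ _, realizes_filter h⟩
  · push Not at h
    obtain ⟨L, hL, h0⟩ := h
    refine Or.inr ?_
    by_cases h' : ∀ i ∈ T.erase L, height i p ≠ 0
    · exact Or.inl ⟨L, hL, _, filter_subset _ _, h0, realizes_filter h'⟩
    · push Not at h'
      obtain ⟨i, hi, hi0⟩ := h'
      exact Or.inr (two_le_mult_iff.2
        ⟨i, mem_of_mem_erase hi, L, hL, ne_of_mem_erase hi, hi0, h0⟩)

/-- The number of bounded sign classes of dimension `d`. -/
noncomputable def numBoundedSignCells (T : Finset (ℝ × ℝ)) (d : ℕ) : ℕ :=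
  {D | (∃ p, D = signCell T p) ∧ Module.finrank ℝ (vectorSpan ℝ D) = d ∧
    Bornology.IsBounded D}.ncard

open Classical in
theorem numBoundedSignCells_two (T : Finset (ℝ × ℝ)) :
    numBoundedSignCells T 2 =
      #{X ∈ patterns height T Set.univ | Bornology.IsBounded {p | Realizes height T X p}} := by
  have himage : {D | (∃ p, D = signCell T p) ∧ Module.finrank ℝ (vectorSpan ℝ D) = 2 ∧
      Bornology.IsBounded D} = (fun X => {p | Realizes height T X p}) ''
      (({X ∈ patterns height T Set.univ | Bornology.IsBounded {p | Realizes height T X p}} :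
        Finset (Finset (ℝ × ℝ))) : Set (Finset (ℝ × ℝ))) := by
    ext D
    constructor
    · rintro ⟨⟨p, rfl⟩, hd, hb⟩
      rcases signCell_cases T p with ⟨X, hX, hp⟩ | ⟨L, hL, X, hX, h0, hp⟩ | h
      · rw [signCell_eq_face hX hp] at hb ⊢
        exact ⟨X, mem_coe.2 (mem_filter.2 ⟨mem_patterns.2 ⟨hX, p, trivial, hp⟩, hb⟩), rfl⟩
      · rw [signCell_eq_edge hL hX h0 hp, finrank_vectorSpan_edge h0 hp] at hd
        omega
      · rw [finrank_vectorSpan_vertex h] at hd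
        omega
    · rintro ⟨X, hX, rfl⟩
      obtain ⟨hX, hb⟩ := mem_filter.1 (mem_coe.1 hX)
      obtain ⟨hX, p, -, hp⟩ := mem_patterns.1 hX
      exact ⟨⟨p, (signCell_eq_face hX hp).symm⟩, finrank_vectorSpan_face hp, hb⟩
  rw [numBoundedSignCells, himage, Set.InjOn.ncard_image, Set.ncard_coe_finset]
  intro X hX Y hY h
  obtain ⟨hX, p, -, hp⟩ := mem_patterns.1 (mem_filter.1 (mem_coe.1 hX)).1
  have hY := (mem_patterns.1 (mem_filter.1 (mem_coe.1 hY)).1).1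
  have hq : p ∈ {p | Realizes height T Y p} := by
    rw [← show {p | Realizes height T X p} = {p | Realizes height T Y p} from h]
    exact hp
  exact (Realizes.eq_filter hX hp).trans (Realizes.eq_filter hY hq).symm

open Classical in
theorem numBoundedSignCells_one (T : Finset (ℝ × ℝ)) :
    numBoundedSignCells T 1 =
      ∑ L ∈ T, #{X ∈ patterns height (T.erase L) {p | height L p = 0} |
        Bornology.IsBounded {p | height L p = 0 ∧ Realizes height (T.erase L) X p}} := by
  rw [← card_sigma]
  set W := T.sigma fun L => {X ∈ patterns height (T.erase L) {p | height L p = 0} |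
    Bornology.IsBounded {p | height L p = 0 ∧ Realizes height (T.erase L) X p}} with hW
  have himage : {D | (∃ p, D = signCell T p) ∧ Module.finrank ℝ (vectorSpan ℝ D) = 1 ∧
      Bornology.IsBounded D} =
      (fun x : Σ _ : ℝ × ℝ, Finset (ℝ × ℝ) =>
        {p | height x.1 p = 0 ∧ Realizes height (T.erase x.1) x.2 p}) '' (W : Set _) := by
    ext D
    constructor
    · rintro ⟨⟨p, rfl⟩, hd, hb⟩
      rcases signCell_cases T p with ⟨X, hX, hp⟩ | ⟨L, hL, X, hX, h0, hp⟩ | h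
      · rw [signCell_eq_face hX hp, finrank_vectorSpan_face hp] at hd
        omega
      · rw [signCell_eq_edge hL hX h0 hp] at hb ⊢
        exact ⟨⟨L, X⟩, mem_coe.2 (mem_sigma.2
          ⟨hL, mem_filter.2 ⟨mem_patterns.2 ⟨hX, p, h0, hp⟩, hb⟩⟩), rfl⟩
      · rw [finrank_vectorSpan_vertex h] at hd
        omega
    · rintro ⟨⟨L, X⟩, hX, rfl⟩
      obtain ⟨hL, hX⟩ := mem_sigma.1 (mem_coe.1 hX)
      obtain ⟨hX, hb⟩ := mem_filter.1 hX
      obtain ⟨hX, p, h0, hp⟩ := mem_patterns.1 hX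
      exact ⟨⟨p, (signCell_eq_edge hL hX h0 hp).symm⟩, finrank_vectorSpan_edge h0 hp, hb⟩
  rw [numBoundedSignCells, himage, Set.InjOn.ncard_image, Set.ncard_coe_finset]
  rintro ⟨L, X⟩ hX ⟨L', Y⟩ hY h
  obtain ⟨hL, hX⟩ := mem_sigma.1 (mem_coe.1 hX)
  obtain ⟨hL', hY⟩ := mem_sigma.1 (mem_coe.1 hY)
  obtain ⟨hX, p, h0, hp⟩ := mem_patterns.1 (mem_filter.1 hX).1
  have hY := (mem_patterns.1 (mem_filter.1 hY).1).1
  have hq : p ∈ {p | height L' p = 0 ∧ Realizes height (T.erase L') Y p} := by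
    rw [← show {p | height L p = 0 ∧ Realizes height (T.erase L) X p} =
      {p | height L' p = 0 ∧ Realizes height (T.erase L') Y p} from h]
    exact ⟨h0, hp⟩
  obtain rfl : L = L' := by
    by_contra hne
    exact hp.ne_zero (mem_erase.2 ⟨Ne.symm hne, hL'⟩) hq.1
  obtain rfl : X = Y := (Realizes.eq_filter hX hp).trans (Realizes.eq_filter hY hq.2).symm
  rfl

/-- A weighted count of the vertices by their multiplicities. -/
theorem sum_vertices_eq {T V : Finset (ℝ × ℝ)} (hV : ∀ p, p ∈ V ↔ 2 ≤ mult T p) (f : ℕ → ℕ) :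
    ∑ p ∈ V, f (mult T p) = ∑ i ∈ Icc 2 #T, f i * {p | mult T p = i}.ncard := by
  rw [← sum_fiberwise_of_maps_to (s := V) (t := Icc 2 #T) (g := mult T)
    fun p hp => mem_Icc.2 ⟨(hV p).1 hp, card_filter_le _ _⟩]
  refine sum_congr rfl fun i hi => ?_
  rw [sum_congr rfl fun p hp => by rw [(mem_filter.1 hp).2], sum_const, smul_eq_mul, mul_comm,
    ← Set.ncard_coe_finset]
  congr 2
  ext p
  rw [mem_coe, mem_filter, hV]
  refine ⟨And.right, fun h => ⟨?_, h⟩⟩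
  rw [Set.mem_ofPred_eq] at h
  rw [h]
  exact (mem_Icc.1 hi).1

/-- The numbers of bounded edges and bounded faces of an arrangement that has a vertex. -/
theorem numBoundedSignCells_formula (T : Finset (ℝ × ℝ)) (hne : ∃ p, 2 ≤ mult T p) :
    numBoundedSignCells T 1 + #T = ∑ i ∈ Icc 2 #T, i * {p | mult T p = i}.ncard ∧
    numBoundedSignCells T 2 + #T = 1 + ∑ i ∈ Icc 2 #T, (i - 1) * {p | mult T p = i}.ncard := by
  classical
  have hV : ∀ p, p ∈ (finite_two_le_mult T).toFinset ↔ 2 ≤ mult T p := fun p => by simp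
  have hpar : ∃ i ∈ T, ∃ j ∈ T, i.1 ≠ j.1 := by
    obtain ⟨p, hp⟩ := hne
    obtain ⟨i, hi, j, hj, hij, hi0, hj0⟩ := two_le_mult_iff.1 hp
    refine ⟨i, hi, j, hj, fun h => hij ?_⟩
    simp only [height] at hi0 hj0
    ext
    · exact h
    · rw [h] at hi0; linarith
  rw [numBoundedSignCells_one, numBoundedSignCells_two, sum_card_bounded_edge_patterns hV hpar,
    card_bounded_patterns _ T (fun p => (hV p).2) hpar, sum_vertices_eq hV fun i => i,
    sum_vertices_eq hV fun i => i - 1]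
  exact ⟨rfl, rfl⟩

/-! ### Coordinates in which no line is vertical -/

/-- If a line is the zero set of an affine function, then two points are strictly on the same side
of it if and only if the function has the same nonzero sign at both. -/
theorem sSameSide_iff_mul_pos {V : Type*} [AddCommGroup V] [Module ℝ V] {L : AffineSubspace ℝ V}
    (hne : (L : Set V).Nonempty) (l : V →ₗ[ℝ] ℝ) (b : ℝ)
    (hL : ∀ x, x ∈ L ↔ l x - b = 0) {x y : V} :
    L.SSameSide x y ↔ 0 < (l x - b) * (l y - b) := by
  constructor
  · rintro ⟨⟨p, hp, r, hr, hray⟩, hx, hy⟩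
    rw [hL] at hp hr hx hy
    simp only [vsub_eq_sub] at hray
    rcases hray with h | h | ⟨u, v, hu, hv, h⟩
    · rw [sub_eq_zero.1 h] at hx
      exact absurd hp hx
    · rw [sub_eq_zero.1 h] at hy
      exact absurd hr hy
    · have h' : u * (l x - b) = v * (l y - b) := by
        have := congrArg l h
        simp only [map_smul, map_sub, smul_eq_mul] at this
        linear_combination this + u * hp - v * hr
      have hxx : 0 < (l x - b) * (l x - b) := mul_self_pos.2 hx
      have : l y - b = u / v * (l x - b) := by field_simp; linarith
      rw [this]
      have : 0 < u / v := div_pos hu hv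
      nlinarith
  · intro h
    have hx : l x - b ≠ 0 := left_ne_zero_of_mul h.ne'
    have hy : l y - b ≠ 0 := right_ne_zero_of_mul h.ne'
    refine ⟨?_, fun h' => hx ((hL x).1 h'), fun h' => hy ((hL y).1 h')⟩
    obtain ⟨p, hp⟩ := hne
    have hp0 := (hL p).1 hp
    have hc : 0 < (l y - b) / (l x - b) := by
      rw [div_eq_mul_inv, ← div_self_mul_self' (l x - b)]
      rw [← mul_div_assoc, mul_comm]
      exact div_pos h (mul_self_pos.2 hx)
    -- the translate of `p` for which `y - r` is a positive multiple of `x - p`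
    refine ⟨p, hp, y - ((l y - b) / (l x - b)) • (x - p), ?_, ?_⟩
    · rw [hL]
      simp only [map_sub, map_smul, smul_eq_mul]
      have : l x - l p = l x - b := by linarith
      rw [this]
      field_simp
      ring
    · simp only [vsub_eq_sub, sub_sub_cancel]
      exact SameRay.sameRay_pos_smul_right _ hc

namespace LineArrangement

theorem nonempty_of_mem {k V : Type*} [Field k] [AddCommGroup V] [Module k V]
    (A : LineArrangement k V) {L : AffineSubspace k V} (hL : L ∈ A.lines) :
    (L : Set V).Nonempty := by
  rw [AffineSubspace.nonempty_iff_ne_bot]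
  rintro rfl
  have h := A.isLine _ hL
  rw [AffineSubspace.direction_bot, finrank_bot] at h
  exact zero_ne_one h

open Classical in
theorem multiplicity_eq_card_filter {k V : Type*} [Field k] [AddCommGroup V] [Module k V]
    (A : LineArrangement k V) (P : V) : A.multiplicity P = #{L ∈ A.lines | P ∈ L} := by
  rw [multiplicity, ← Set.ncard_coe_finset]
  congr 1
  ext L
  simp

/-- A vector in the direction of none of the lines can be made vertical; then every line is the
graph of an affine function. -/
theorem exists_coordinates (A : LineArrangement ℝ (EuclideanSpace ℝ (Fin 2))) :
    ∃ (Φ : EuclideanSpace ℝ (Fin 2) ≃L[ℝ] ℝ × ℝ)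
      (c : AffineSubspace ℝ (EuclideanSpace ℝ (Fin 2)) → ℝ × ℝ),
      ∀ L ∈ A.lines, ∀ x, x ∈ L ↔ height (c L) (Φ x) = 0 := by
  classical
  have h2 : Module.finrank ℝ (EuclideanSpace ℝ (Fin 2)) = 2 := by simp
  obtain ⟨u, hu⟩ : ∃ u : EuclideanSpace ℝ (Fin 2), u ∉
      ⋃ p ∈ insert ⊥ (A.lines.image AffineSubspace.direction),
        (p : Set (EuclideanSpace ℝ (Fin 2))) := by
    rw [← Set.ne_univ_iff_exists_notMem]
    refine Subspace.biUnion_ne_univ_of_top_notMem fun h => ?_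
    rcases mem_insert.1 h with h | h
    · have := congrArg (fun p : Submodule ℝ (EuclideanSpace ℝ (Fin 2)) => Module.finrank ℝ p) h
      simp at this
    · obtain ⟨L, hL, h⟩ := mem_image.1 h
      have := A.isLine L hL
      rw [h, finrank_top, h2] at this
      omega
  simp only [Set.mem_iUnion, not_exists] at hu
  have hu0 : u ≠ 0 := fun h => hu ⊥ (mem_insert_self _ _) (by simp [h])
  have hudir : ∀ L ∈ A.lines, u ∉ L.direction := fun L hL h =>
    hu L.direction (mem_insert_of_mem (mem_image_of_mem _ hL)) h
  obtain ⟨w, hw⟩ : ∃ w : EuclideanSpace ℝ (Fin 2), w ∉ Submodule.span ℝ {u} := by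
    by_contra! h
    have h1 := finrank_span_singleton (K := ℝ) hu0
    rw [Submodule.eq_top_iff'.2 h, finrank_top, h2] at h1
    omega
  have hli : LinearIndependent ℝ ![u, w] :=
    (LinearIndependent.pair_iff' hu0).2 fun a ha => hw (Submodule.mem_span_singleton.2 ⟨a, ha⟩)
  let B := basisOfLinearIndependentOfCardEqFinrank hli (by simp)
  have hB0 : B 0 = u := by simp [B]
  let Ψ : EuclideanSpace ℝ (Fin 2) ≃ₗ[ℝ] ℝ × ℝ :=
    (B.equivFun.trans (LinearEquiv.finTwoArrow ℝ ℝ)).trans (LinearEquiv.prodComm ℝ ℝ ℝ)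
  have hΨu : Ψ u = (0, 1) := by
    have : B.equivFun u = ![1, 0] := by
      rw [← hB0]
      ext i
      fin_cases i <;> simp [Module.Basis.equivFun_self]
    simp [Ψ, this]
  refine ⟨Ψ.toContinuousLinearEquiv, ?_⟩
  have hline : ∀ L ∈ A.lines, ∃ c : ℝ × ℝ, ∀ x, x ∈ L ↔ height c (Ψ x) = 0 := by
    intro L hL
    obtain ⟨p, hp⟩ := A.nonempty_of_mem hL
    obtain ⟨⟨d, hd⟩, hd0, hspan⟩ := finrank_eq_one_iff'.1 (A.isLine L hL)
    have hd0 : d ≠ 0 := fun h => hd0 (Subtype.ext h)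
    have hd1 : (Ψ d).1 ≠ 0 := by
      intro h
      have hdu : d = (Ψ d).2 • u := by
        apply Ψ.injective
        rw [map_smul, hΨu]
        ext <;> simp [h]
      have hne : (Ψ d).2 ≠ 0 := by
        intro h'
        rw [h', zero_smul] at hdu
        exact hd0 hdu
      apply hudir L hL
      rw [hdu] at hd
      exact (Submodule.smul_mem_iff _ hne).1 hd
    refine ⟨((Ψ d).2 / (Ψ d).1, (Ψ p).2 - (Ψ d).2 / (Ψ d).1 * (Ψ p).1), fun x => ?_⟩
    have hx : x ∈ L ↔ x - p ∈ L.direction := by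
      rw [← vsub_eq_sub, AffineSubspace.vsub_right_mem_direction_iff_mem hp]
    rw [hx]
    constructor
    · intro h
      obtain ⟨a, ha⟩ := hspan ⟨x - p, h⟩
      have ha : a • d = x - p := congrArg Subtype.val ha
      have hxa : Ψ x = Ψ p + a • Ψ d := by
        rw [← map_smul, ha, map_sub, add_sub_cancel]
      rw [hxa]
      simp only [height, Prod.fst_add, Prod.snd_add, Prod.smul_fst, Prod.smul_snd, smul_eq_mul]
      field_simp
      ring
    · intro h
      have : x - p = (((Ψ x).1 - (Ψ p).1) / (Ψ d).1) • d := by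
        apply Ψ.injective
        rw [map_smul, map_sub]
        simp only [height] at h
        ext
        · simp only [Prod.fst_sub, Prod.smul_fst, smul_eq_mul]
          field_simp
        · simp only [Prod.snd_sub, Prod.smul_snd, smul_eq_mul]
          linear_combination h
      rw [this]
      exact Submodule.smul_mem _ _ hd
  choose! c hc using hline
  exact ⟨c, hc⟩

section Transport

variable {A : LineArrangement ℝ (EuclideanSpace ℝ (Fin 2))}
  {Φ : EuclideanSpace ℝ (Fin 2) ≃L[ℝ] ℝ × ℝ}
  {c : AffineSubspace ℝ (EuclideanSpace ℝ (Fin 2)) → ℝ × ℝ}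

theorem injOn_coordinates (hc : ∀ L ∈ A.lines, ∀ x, x ∈ L ↔ height (c L) (Φ x) = 0) :
    Set.InjOn c (A.lines : Set (AffineSubspace ℝ (EuclideanSpace ℝ (Fin 2)))) := by
  intro L hL L' hL' h
  ext x
  rw [hc L hL, hc L' hL', h]

theorem multiplicity_eq_mult [DecidableEq (ℝ × ℝ)]
    (hc : ∀ L ∈ A.lines, ∀ x, x ∈ L ↔ height (c L) (Φ x) = 0) (P : EuclideanSpace ℝ (Fin 2)) :
    A.multiplicity P = mult (A.lines.image c) (Φ P) := by
  classical
  rw [multiplicity_eq_card_filter, mult, filter_image, card_image_of_injOn]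
  · congr 1
    exact filter_congr fun L hL => hc L hL P
  · exact (injOn_coordinates hc).mono fun L hL => (mem_filter.1 hL).1

theorem numPoints_eq_ncard_mult [DecidableEq (ℝ × ℝ)]
    (hc : ∀ L ∈ A.lines, ∀ x, x ∈ L ↔ height (c L) (Φ x) = 0) (i : ℕ) :
    A.numPoints i = {p | mult (A.lines.image c) p = i}.ncard := by
  have : {p | mult (A.lines.image c) p = i} = Φ '' {P | A.multiplicity P = i} := by
    ext p
    constructor
    · intro h
      refine ⟨Φ.symm p, ?_, Φ.apply_symm_apply p⟩
      rwa [Set.mem_ofPred_eq, multiplicity_eq_mult hc, Φ.apply_symm_apply]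
    · rintro ⟨P, h, rfl⟩
      rwa [Set.mem_ofPred_eq, multiplicity_eq_mult hc] at h
  rw [this, Set.ncard_image_of_injective _ Φ.injective, numPoints]

theorem cellSetoid_iff_mem_signCell [DecidableEq (ℝ × ℝ)]
    (hc : ∀ L ∈ A.lines, ∀ x, x ∈ L ↔ height (c L) (Φ x) = 0) (x y : EuclideanSpace ℝ (Fin 2)) :
    A.cellSetoid x y ↔ Φ x ∈ signCell (A.lines.image c) (Φ y) := by
  change (∀ L ∈ A.lines, (x ∈ L ∧ y ∈ L) ∨ L.SSameSide x y) ↔ _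
  simp only [signCell, Set.mem_ofPred_eq, forall_mem_image]
  refine forall₂_congr fun L hL => ?_
  let l : EuclideanSpace ℝ (Fin 2) →ₗ[ℝ] ℝ :=
    (LinearMap.snd ℝ ℝ ℝ - (c L).1 • LinearMap.fst ℝ ℝ ℝ).comp
      (Φ.toLinearEquiv : EuclideanSpace ℝ (Fin 2) →ₗ[ℝ] ℝ × ℝ)
  have hl : ∀ x, l x - (c L).2 = height (c L) (Φ x) := by
    intro x
    simp only [l, height, LinearMap.comp_apply, LinearMap.sub_apply, LinearMap.smul_apply,
      LinearMap.snd_apply, LinearMap.fst_apply, smul_eq_mul, LinearEquiv.coe_coe,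
      ContinuousLinearEquiv.coe_toLinearEquiv]
    ring
  rw [sSameSide_iff_mul_pos (A.nonempty_of_mem hL) l (c L).2
    (fun x => by rw [hl]; exact hc L hL x), hl, hl, hc L hL, hc L hL]
  generalize height (c L) (Φ x) = a
  generalize height (c L) (Φ y) = b
  rcases lt_trichotomy a 0 with ha | ha | ha <;> rcases lt_trichotomy b 0 with hb | hb | hb
  · simp [ha, hb, mul_pos_of_neg_of_neg ha hb]
  · simp [ha, hb, ha.ne]
  · simp [ha, hb, ha.ne, ha.le]
  · simp [ha, hb, hb.ne]
  · simp [ha, hb]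
  · simp [ha, hb, hb.ne']
  · simp [ha, hb, ha.ne', hb.le]
  · simp [ha, hb, ha.ne']
  · simp [ha, hb, mul_pos ha hb]

theorem numBoundedCells_eq_numBoundedSignCells [DecidableEq (ℝ × ℝ)]
    (hc : ∀ L ∈ A.lines, ∀ x, x ∈ L ↔ height (c L) (Φ x) = 0) (d : ℕ) :
    A.numBoundedCells d = numBoundedSignCells (A.lines.image c) d := by
  have hcell : ∀ y, {x | A.cellSetoid x y} = Φ ⁻¹' signCell (A.lines.image c) (Φ y) :=
    fun y => Set.ext fun x => cellSetoid_iff_mem_signCell hc x y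
  have hdim : ∀ D : Set (ℝ × ℝ), Module.finrank ℝ (vectorSpan ℝ (Φ ⁻¹' D)) =
      Module.finrank ℝ (vectorSpan ℝ D) := by
    intro D
    have h := AffineMap.map_vectorSpan (k := ℝ)
      (Φ.toLinearEquiv : EuclideanSpace ℝ (Fin 2) →ₗ[ℝ] ℝ × ℝ).toAffineMap
      (s := Φ ⁻¹' D)
    have h' : (Φ.toLinearEquiv : EuclideanSpace ℝ (Fin 2) →ₗ[ℝ] ℝ × ℝ).toAffineMap ''
        (Φ ⁻¹' D) = D := Set.image_preimage_eq D Φ.surjective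
    rw [h'] at h
    rw [← h]
    exact (LinearEquiv.finrank_map_eq Φ.toLinearEquiv _).symm
  have hbdd : ∀ D : Set (ℝ × ℝ), Bornology.IsBounded (Φ ⁻¹' D) ↔ Bornology.IsBounded D := by
    intro D
    refine ⟨fun h => ?_, fun h => Φ.antilipschitz.isBounded_preimage h⟩
    have := Φ.lipschitz.isBounded_image h
    rwa [Set.image_preimage_eq D Φ.surjective] at this
  have himage : {C | C ∈ A.cells ∧ Module.finrank ℝ (vectorSpan ℝ C) = d ∧
      Bornology.IsBounded C} = (Φ ⁻¹' ·) '' {D | (∃ p, D = signCell (A.lines.image c) p) ∧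
        Module.finrank ℝ (vectorSpan ℝ D) = d ∧ Bornology.IsBounded D} := by
    ext C
    constructor
    · rintro ⟨⟨y, rfl⟩, hd, hb⟩
      rw [hcell] at hd hb ⊢
      rw [hdim] at hd
      rw [hbdd] at hb
      exact ⟨_, ⟨⟨Φ y, rfl⟩, hd, hb⟩, rfl⟩
    · rintro ⟨_, ⟨⟨p, rfl⟩, hd, hb⟩, rfl⟩
      refine ⟨⟨Φ.symm p, ?_⟩, (hdim _).trans hd, (hbdd _).2 hb⟩
      rw [hcell, Φ.apply_symm_apply]
  rw [numBoundedCells, himage, Set.ncard_image_of_injective _ Φ.surjective.preimage_injective,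
    numBoundedSignCells]

/-- The numbers of bounded edges and bounded faces of a real line arrangement with at least one
vertex, in terms of the numbers of points of each multiplicity. -/
theorem numBoundedCells_formula (A : LineArrangement ℝ (EuclideanSpace ℝ (Fin 2)))
    (hne : ∃ i ≥ 2, A.numPoints i ≠ 0) :
    A.numBoundedCells 1 + A.card = ∑ i ∈ Icc 2 A.card, i * A.numPoints i ∧
    A.numBoundedCells 2 + A.card = 1 + ∑ i ∈ Icc 2 A.card, (i - 1) * A.numPoints i := by
  classical
  obtain ⟨Φ, c, hc⟩ := A.exists_coordinates
  have hcard : A.card = #(A.lines.image c) :=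
    (card_image_of_injOn (injOn_coordinates hc)).symm
  simp only [hcard, numBoundedCells_eq_numBoundedSignCells hc, numPoints_eq_ncard_mult hc] at hne ⊢
  refine numBoundedSignCells_formula _ ?_
  obtain ⟨i, hi, h⟩ := hne
  obtain ⟨p, hp⟩ := Set.nonempty_of_ncard_ne_zero h
  rw [Set.mem_ofPred_eq] at hp
  exact ⟨p, by rwa [hp]⟩

end Transport

/-! ### Counting incidences in a finite plane -/

section FinitePlane

variable {K : Type*} [Field K]

theorem ncard_line (F : LineArrangement K (Fin 2 → K)) {L : AffineSubspace K (Fin 2 → K)}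
    (hL : L ∈ F.lines) : (L : Set (Fin 2 → K)).ncard = Nat.card K := by
  obtain ⟨p, hp⟩ := F.nonempty_of_mem hL
  have h : (L : Set (Fin 2 → K)) = (· + p) '' (L.direction : Set (Fin 2 → K)) := by
    ext x
    rw [Set.mem_image]
    constructor
    · intro hx
      exact ⟨x - p, AffineSubspace.vsub_mem_direction hx hp, sub_add_cancel x p⟩
    · rintro ⟨v, hv, rfl⟩
      exact AffineSubspace.vadd_mem_of_mem_direction hv hp
  rw [h, Set.ncard_image_of_injective _ (add_left_injective p), ← Nat.card_coe_set_eq]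
  change Nat.card L.direction = _
  rw [Module.natCard_eq_pow_finrank (K := K), F.isLine L hL, pow_one]

theorem sum_multiplicity [Fintype (Fin 2 → K)] (F : LineArrangement K (Fin 2 → K)) :
    ∑ P, F.multiplicity P = F.card * Nat.card K := by
  classical
  simp only [multiplicity_eq_card_filter, card_filter]
  rw [sum_comm, card, ← smul_eq_mul, ← sum_const]
  refine sum_congr rfl fun L hL => ?_
  rw [← F.ncard_line hL, ← card_filter, ← Set.ncard_coe_finset]
  congr 1
  ext P
  simp

theorem sum_comp_multiplicity [Fintype (Fin 2 → K)] (F : LineArrangement K (Fin 2 → K))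
    (f : ℕ → ℕ) : ∑ P, f (F.multiplicity P) = ∑ i ∈ range (F.card + 1), f i * F.numPoints i := by
  classical
  rw [← sum_fiberwise_of_maps_to (t := range (F.card + 1)) (g := F.multiplicity) fun P _ => by
    rw [mem_range, Nat.lt_succ_iff, multiplicity_eq_card_filter]
    exact card_filter_le _ _]
  refine sum_congr rfl fun i _ => ?_
  rw [sum_congr rfl fun P hP => by rw [(mem_filter.1 hP).2], sum_const, smul_eq_mul, mul_comm,
    numPoints, ← Set.ncard_coe_finset]
  congr 2
  ext P
  simp

theorem sum_range_succ_eq_add_sum_Icc (f : ℕ → ℕ) {n : ℕ} (hn : 1 ≤ n) :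
    ∑ i ∈ range (n + 1), f i = f 0 + f 1 + ∑ i ∈ Icc 2 n, f i := by
  rw [range_eq_Ico, sum_eq_sum_Ico_succ_bot (by omega), sum_eq_sum_Ico_succ_bot (by omega),
    ← add_assoc]
  congr 1

/-- Every point of the plane has some multiplicity. -/
theorem numPoints_sum_eq [Finite K] (F : LineArrangement K (Fin 2 → K)) (hF : 1 ≤ F.card) :
    F.numPoints 0 + F.numPoints 1 + ∑ i ∈ Icc 2 F.card, F.numPoints i = Nat.card K ^ 2 := by
  have := Fintype.ofFinite (Fin 2 → K)
  have h := F.sum_comp_multiplicity fun _ => 1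
  simp only [one_mul] at h
  rw [sum_range_succ_eq_add_sum_Icc _ hF] at h
  rw [← h, ← card_eq_sum_ones, card_univ, ← Nat.card_eq_fintype_card, Nat.card_fun, Nat.card_fin]

/-- The number of incidences between points and lines, counted in two ways. -/
theorem numPoints_weighted_sum_eq [Finite K] (F : LineArrangement K (Fin 2 → K)) (hF : 1 ≤ F.card) :
    F.numPoints 1 + ∑ i ∈ Icc 2 F.card, i * F.numPoints i = F.card * Nat.card K := by
  have := Fintype.ofFinite (Fin 2 → K)
  have h := F.sum_comp_multiplicity fun i => i
  rw [sum_range_succ_eq_add_sum_Icc _ hF, F.sum_multiplicity] at h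
  rw [h]
  ring

end FinitePlane

end LineArrangement

/-! ### Comparison of the two planes -/

theorem mainTheorem2 {K : Type*} [Field K] [Finite K] (q : ℕ) (hq : Nat.card K = q)
    (F : LineArrangement K (Fin 2 → K)) (hF : F.card = q + 1)
    (A : LineArrangement ℝ (EuclideanSpace ℝ (Fin 2))) (hA : F.SameClass A) :
    (A.numBoundedCells 1 : ℤ) = ((q : ℤ) + 1) * ((q : ℤ) - 1) - (F.numPoints 1 : ℤ) ∧
      A.numBoundedCells 2 = F.numPoints 0 := by
  obtain ⟨hcard, hpts⟩ := hA
  have hqpos : 0 < q := hq ▸ Nat.card_pos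
  have h0 := F.numPoints_sum_eq (by omega)
  have h1 := F.numPoints_weighted_sum_eq (by omega)
  rw [hq] at h0 h1
  -- `(q + 1) * q` incidences at only `q ^ 2` points: two lines must meet
  have hne : ∃ i ≥ 2, A.numPoints i ≠ 0 := by
    by_contra! h
    have hz : ∀ i ∈ Icc 2 F.card, F.numPoints i = 0 := fun i hi => by
      rw [hpts i hi, h i (mem_Icc.1 hi).1]
    rw [sum_eq_zero hz] at h0
    rw [sum_eq_zero fun i hi => by rw [hz i hi, mul_zero], hF] at h1
    nlinarith
  obtain ⟨he, hf⟩ := A.numBoundedCells_formula hne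
  rw [← hcard] at he hf
  rw [sum_congr rfl fun i hi => congrArg (i * ·) (hpts i hi).symm] at he
  rw [sum_congr rfl fun i hi => congrArg ((i - 1) * ·) (hpts i hi).symm] at hf
  have hsplit : ∑ i ∈ Icc 2 F.card, i * F.numPoints i =
      ∑ i ∈ Icc 2 F.card, (i - 1) * F.numPoints i + ∑ i ∈ Icc 2 F.card, F.numPoints i := by
    rw [← sum_add_distrib]
    refine sum_congr rfl fun i hi => ?_
    obtain ⟨j, rfl⟩ := Nat.exists_eq_add_of_le (mem_Icc.1 hi).1
    rw [show 2 + j - 1 = 1 + j by omega]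
    ring
  rw [hF] at h0 h1 he hf hsplit
  constructor
  · zify at he h1
    linear_combination he + h1
  · nlinarith
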